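/- Let $X$ be a measurable space with a nonzero reference measure $\nu$ (for instance the counting measure on a nonempty discrete set $X$, in which case the integrals below are sums, or Lebesgue measure on a measurable set $X\subseteq\mathbb{R}^N$ of positive measure). Let $\mathcal{M}$ be a finite index set with $M$ elements, let $\varphi_m:X\to\mathbb{R}$ be measurable and $\Lambda_m>0$ for $m\in\mathcal{M}$. For $\theta\in\mathbb{R}^M$ put $$E_\theta=\sum_{m}\theta_m\varphi_m,\quad Z_\theta=\int_X e^{-E_\theta}\,d\nu,\quad \pi_\theta=\frac{1}{Z_\theta}e^{-E_\theta},\quad \eta_m(\theta)=\eta_m(\pi_\theta),\quad\text{where } \eta_m(p)=\int_X\varphi_m\,p\,d\nu,$$ and let $\mathcal{D}\subseteq\mathbb{R}^M$ be the set of all $\theta$ for which the integrals $\int_X e^{-E_\theta}\,d\nu$ and $\int_X\varphi_m e^{-E_\theta}\,d\nu$, $m\in\mathcal{M}$, are finite (converge absolutely). Assume that $\mathcal{D}=\mathbb{R}^M$ and that for each $m\in\mathcal{M}$ there are $\bar A_m,\bar B_m\in\mathbb{R}$ with $\bar A_m\le\eta_m(\theta)\le\bar B_m$ for all $\theta\in\mathbb{R}^M$.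 Then for every $\mu\in\mathbb{R}^M$ there is $\theta^*\in\mathbb{R}^M$ with $$\theta^*_m=\Lambda_m\bigl(\eta_m(\theta^*)-\mu_m\bigr)\quad\text{for all } m\in\mathcal{M},$$ and the Gibbs density $\pi_{\theta^*}$ is a minimizer of the target function $$\mathcal{L}(p)=\frac12\sum_{m}\Lambda_m\bigl(\eta_m(p)-\mu_m\bigr)^2-H(p),\qquad H(p)=-\int_X p\log p\,d\nu,$$ among all probability densities $p$ with respect to $\nu$ such that $\varphi_m p$ is $\nu$-integrable for all $m\in\mathcal{M}$ (where $H(p)$ and $\mathcal{L}(p)$ are extended real numbers). -/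

import Mathlib

open MeasureTheory
open scoped ENNReal

namespace EntropicHerding

noncomputable section

variable {X ι : Type*} [MeasurableSpace X] [Fintype ι]

/-- The energy `E_θ(x) = ∑ m, θ_m φ_m(x)` for feature functions `φ m : X → ℝ`. -/
def energy (φ : ι → X → ℝ) (θ : ι → ℝ) (x : X) : ℝ :=
  ∑ m, θ m * φ m x

/-- The partition function `Z_θ = ∫ exp(-E_θ(x)) dν(x)`. The reference measure `ν` is the
counting measure if `X` is discrete, and Lebesgue measure (restricted to `X`) if `X ⊆ ℝ^N`. -/
def partitionFn (ν : Measure X) (φ : ι → X → ℝ) (θ : ι → ℝ) : ℝ :=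
  ∫ x, Real.exp (-energy φ θ x) ∂ν

/-- The Gibbs density `π_θ(x) = exp(-E_θ(x)) / Z_θ` with respect to `ν`. -/
def gibbs (ν : Measure X) (φ : ι → X → ℝ) (θ : ι → ℝ) (x : X) : ℝ :=
  1 / partitionFn ν φ θ * Real.exp (-energy φ θ x)

/-- The mean `η(p) = ∫ f(x) p(x) dν(x)` of a feature `f` under the density `p`. -/
def featureMean (ν : Measure X) (f : X → ℝ) (p : X → ℝ) : ℝ :=
  ∫ x, f x * p x ∂ν

/-- The Gibbs feature mean `η_m(θ) = η_m(π_θ)`. -/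
def gibbsMean (ν : Measure X) (φ : ι → X → ℝ) (m : ι) (θ : ι → ℝ) : ℝ :=
  featureMean ν (φ m) (gibbs ν φ θ)

/-- The set `𝒟` of the parameters `θ` for which the integrals defining the partition function and
the feature means are finite. -/
def paramDomain (ν : Measure X) (φ : ι → X → ℝ) : Set (ι → ℝ) :=
  {θ | Integrable (fun x => Real.exp (-energy φ θ x)) ν ∧
    ∀ m, Integrable (fun x => φ m x * Real.exp (-energy φ θ x)) ν}

/-- `p` is a probability density with respect to `ν`. -/
def IsProbDensity (ν : Measure X) (p : X → ℝ) : Prop :=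
  (0 ≤ᵐ[ν] p) ∧ Integrable p ν ∧ ∫ x, p x ∂ν = 1

/-- The probability densities whose feature means are all finite: the densities on which the
target function is considered. -/
def densities (ν : Measure X) (φ : ι → X → ℝ) : Set (X → ℝ) :=
  {p | IsProbDensity ν p ∧ ∀ m, Integrable (fun x => φ m x * p x) ν}

/-- The (differential) entropy `H(p) = -∫ p log p dν` as an extended real number: the integral of
the positive part of `-p log p` minus the integral of its negative part. -/
def entropy (ν : Measure X) (p : X → ℝ) : EReal :=
  ((∫⁻ x, ENNReal.ofReal (-(p x * Real.log (p x))) ∂ν : ℝ≥0∞) : EReal) -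
    ((∫⁻ x, ENNReal.ofReal (p x * Real.log (p x)) ∂ν : ℝ≥0∞) : EReal)

/-- The target function `ℒ(p) = (1/2) ∑ m, Λ_m (η_m(p) - μ_m)² - H(p)`. -/
def target (ν : Measure X) (φ : ι → X → ℝ) (Λ μ : ι → ℝ) (p : X → ℝ) : EReal :=
  ((1 / 2 * ∑ m, Λ m * (featureMean ν (φ m) p - μ m) ^ 2 : ℝ) : EReal) - entropy ν p

end

end EntropicHerding

namespace EntropicHerding

/-! ### Linearity of the energy in the parameter. -/

section Energy

variable {X ι : Type*} [Fintype ι] {φ : ι → X → ℝ}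

/-! The equation for `θ*` is the stationarity condition of the convex dual log Z_θ + ∑ (θ_m² /
(2Λ_m) + μ_m θ_m), because ∂_m log Z_θ = -η_m(θ) (`hasDerivAt_dual`). By Jensen, log Z_θ has an
affine lower bound, so the quadratic term makes the dual coercive; being continuous, it attains its
minimum (`exists_dual_minimizer`).

Optimality (`target_gibbs_le`): Gibbs' inequality gives -H(p) ≥ ∫ p log π_θ, with equality at p =
π_θ, and the right side is affine in the feature means, with slope -θ. At a stationary θ this slope
cancels the gradient of the quadratic penalty at η(θ), so convexity of the penalty finishes the
proof. -/

theorem energy_add (θ θ' : ι → ℝ) (x : X) :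
    energy φ (θ + θ') x = energy φ θ x + energy φ θ' x := by
  simp [energy, add_mul, Finset.sum_add_distrib]

theorem energy_smul (c : ℝ) (θ : ι → ℝ) (x : X) :
    energy φ (c • θ) x = c * energy φ θ x := by
  simp [energy, Finset.mul_sum, mul_assoc]

theorem energy_single [DecidableEq ι] (m : ι) (t : ℝ) (x : X) :
    energy φ (Pi.single m t) x = t * φ m x := by
  simp [energy, Pi.single_apply, ite_mul]

end Energy

/-! ### Regularity and growth of the partition function. -/

section Partition

variable {X ι : Type*} [MeasurableSpace X] [Fintype ι] {ν : Measure X} {φ : ι → X → ℝ}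

theorem integrable_exp_neg_energy (hD : paramDomain ν φ = Set.univ) (θ : ι → ℝ) :
    Integrable (fun x => Real.exp (-energy φ θ x)) ν :=
  (show θ ∈ paramDomain ν φ by rw [hD]; trivial).1

theorem integrable_mul_exp_neg_energy (hD : paramDomain ν φ = Set.univ) (θ : ι → ℝ) (m : ι) :
    Integrable (fun x => φ m x * Real.exp (-energy φ θ x)) ν :=
  (show θ ∈ paramDomain ν φ by rw [hD]; trivial).2 m

theorem isFiniteMeasure_of_paramDomain (hD : paramDomain ν φ = Set.univ) :
    IsFiniteMeasure ν := by
  have h := integrable_exp_neg_energy hD 0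
  simpa [energy, integrable_const_iff] using h

theorem integrable_feature (hD : paramDomain ν φ = Set.univ) (m : ι) : Integrable (φ m) ν := by
  simpa [energy] using integrable_mul_exp_neg_energy hD 0 m

theorem partitionFn_pos (hν : ν ≠ 0) (hD : paramDomain ν φ = Set.univ) (θ : ι → ℝ) :
    0 < partitionFn ν φ θ := by
  have : NeZero ν := ⟨hν⟩
  exact integral_exp_pos (integrable_exp_neg_energy hD θ)

theorem convexOn_partitionFn (hD : paramDomain ν φ = Set.univ) :
    ConvexOn ℝ Set.univ (partitionFn ν φ) := by
  refine ⟨convex_univ, fun θ _ θ' _ a b ha hb hab => ?_⟩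
  have h1 := (integrable_exp_neg_energy hD θ).const_mul a
  have h2 := (integrable_exp_neg_energy hD θ').const_mul b
  simp only [partitionFn, smul_eq_mul]
  rw [← integral_const_mul, ← integral_const_mul, ← integral_add h1 h2]
  refine integral_mono (integrable_exp_neg_energy hD _) (h1.add h2) fun x => ?_
  have h := convexOn_exp.2 (Set.mem_univ (-energy φ θ x)) (Set.mem_univ (-energy φ θ' x)) ha hb hab
  simp only [smul_eq_mul] at h
  have e : -energy φ (a • θ + b • θ') x = a * -energy φ θ x + b * -energy φ θ' x := by
    rw [energy_add, energy_smul, energy_smul]; ring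
  simpa only [e] using h

/-- A finite convex function on a finite-dimensional space is continuous. -/
theorem continuous_partitionFn (hD : paramDomain ν φ = Set.univ) :
    Continuous (partitionFn ν φ) :=
  continuousOn_univ.1 ((convexOn_partitionFn hD).continuousOn isOpen_univ)

/-- The exponent is affine in `t`, hence at most its larger value at `t = ±1`. This dominates the
differentiated integrand by two functions that are integrable because `𝒟` is everything. -/
theorem abs_mul_exp_le (a s t : ℝ) (ht : |t| ≤ 1) :
    |s * Real.exp (a - t * s)| ≤ |s * Real.exp (a - s)| + |s * Real.exp (a + s)| := by
  simp only [abs_mul, Real.abs_exp, ← mul_add]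
  refine mul_le_mul_of_nonneg_left ?_ (abs_nonneg s)
  have h1 : -(t * s) ≤ |s| := by
    calc -(t * s) ≤ |t * s| := neg_le_abs _
      _ = |t| * |s| := abs_mul t s
      _ ≤ |s| := mul_le_of_le_one_left (abs_nonneg s) ht
  rcases abs_cases s with ⟨h, _⟩ | ⟨h, _⟩
  · have := Real.exp_le_exp.2 (show a - t * s ≤ a + s by linarith)
    linarith [Real.exp_pos (a - s)]
  · have := Real.exp_le_exp.2 (show a - t * s ≤ a - s by linarith)
    linarith [Real.exp_pos (a + s)]

theorem hasDerivAt_partitionFn [DecidableEq ι] (hD : paramDomain ν φ = Set.univ)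
    (θ : ι → ℝ) (m : ι) :
    HasDerivAt (fun t => partitionFn ν φ (θ + Pi.single m t))
      (-∫ x, φ m x * Real.exp (-energy φ θ x) ∂ν) 0 := by
  have e (t : ℝ) (x : X) :
      -energy φ (θ + Pi.single m t) x = -energy φ θ x - t * φ m x := by
    rw [energy_add, energy_single]; ring
  have b1 := integrable_mul_exp_neg_energy hD (θ + Pi.single m 1) m
  have b2 := integrable_mul_exp_neg_energy hD (θ + Pi.single m (-1)) m
  have key := hasDerivAt_integral_of_dominated_loc_of_deriv_le (μ := ν) (x₀ := (0 : ℝ))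
    (F := fun t x => Real.exp (-energy φ θ x - t * φ m x))
    (F' := fun t x => -(φ m x * Real.exp (-energy φ θ x - t * φ m x)))
    (bound := fun x => |φ m x * Real.exp (-energy φ θ x - φ m x)| +
      |φ m x * Real.exp (-energy φ θ x + φ m x)|)
    (s := Metric.ball 0 1) (Metric.ball_mem_nhds 0 one_pos)
    (Filter.Eventually.of_forall fun t => by
      have h := (integrable_exp_neg_energy hD (θ + Pi.single m t)).aestronglyMeasurable
      simp only [e] at h
      exact h)
    (by simpa using integrable_exp_neg_energy hD θ)
    (by simpa using (integrable_mul_exp_neg_energy hD θ m).aestronglyMeasurable.fun_neg)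
    (Filter.Eventually.of_forall fun x t ht => by
      rw [Real.norm_eq_abs, abs_neg]
      refine abs_mul_exp_le _ _ _ ?_
      simpa using (Metric.mem_ball.1 ht).le)
    (by
      refine Integrable.add ?_ ?_
      · simpa only [e, one_mul] using b1.abs
      · simpa only [e, neg_mul, one_mul, sub_neg_eq_add] using b2.abs)
    (Filter.Eventually.of_forall fun x t _ => by
      have h : HasDerivAt (fun t : ℝ => -energy φ θ x - t * φ m x) (-φ m x) t := by
        simpa using ((hasDerivAt_id t).mul_const (φ m x)).const_sub (-energy φ θ x)
      exact h.exp.congr_deriv (by beta_reduce; ring))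
  have h := key.2
  simp only [partitionFn, e]
  simpa [integral_neg] using h

/-- Jensen's inequality for `exp` under normalized `ν`, which is finite since `0 ∈ 𝒟`: integrate the
tangent line of `exp` at `a`, the mean of `-E_θ`. -/
theorem partitionFn_lower_bound (hν : ν ≠ 0) (hD : paramDomain ν φ = Set.univ) (θ : ι → ℝ) :
    partitionFn ν φ 0 * Real.exp (-∑ m, θ m * ((∫ x, φ m x ∂ν) / partitionFn ν φ 0)) ≤
      partitionFn ν φ θ := by
  have := isFiniteMeasure_of_paramDomain hD
  have hZ := partitionFn_pos hν hD 0
  set a := -∑ m, θ m * ((∫ x, φ m x ∂ν) / partitionFn ν φ 0) with ha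
  have hE : Integrable (energy φ θ) ν :=
    integrable_finsetSum _ fun m _ => (integrable_feature hD m).const_mul (θ m)
  have hiE : ∫ x, energy φ θ x ∂ν = -a * partitionFn ν φ 0 := by
    simp only [energy]
    rw [integral_finsetSum _ fun m _ => (integrable_feature hD m).const_mul (θ m), ha, neg_neg,
      Finset.sum_mul]
    refine Finset.sum_congr rfl fun m _ => ?_
    rw [integral_const_mul]
    field_simp
  have h0 : partitionFn ν φ 0 = ν.real Set.univ := by simp [partitionFn, energy]
  have hi : Integrable (fun x => Real.exp a * ((1 - a) - energy φ θ x)) ν :=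
    ((integrable_const _).sub hE).const_mul _
  calc partitionFn ν φ 0 * Real.exp a = ∫ x, Real.exp a * ((1 - a) - energy φ θ x) ∂ν := by
        rw [integral_const_mul, integral_sub (integrable_const _) hE, hiE, integral_const,
          smul_eq_mul, ← h0]
        ring
    _ ≤ partitionFn ν φ θ := by
        refine integral_mono hi (integrable_exp_neg_energy hD θ) fun x => ?_
        have h := Real.add_one_le_exp (-energy φ θ x - a)
        calc Real.exp a * ((1 - a) - energy φ θ x)
            ≤ Real.exp a * Real.exp (-energy φ θ x - a) :=
              mul_le_mul_of_nonneg_left (by linarith) (Real.exp_pos a).le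
          _ = Real.exp (-energy φ θ x) := by rw [← Real.exp_add]; congr 1; ring

theorem gibbsMean_eq (m : ι) (θ : ι → ℝ) :
    gibbsMean ν φ m θ =
      (∫ x, φ m x * Real.exp (-energy φ θ x) ∂ν) / partitionFn ν φ θ := by
  simp only [gibbsMean, featureMean, gibbs]
  rw [← one_div_mul_eq_div _ (∫ x, φ m x * _ ∂ν), ← integral_const_mul]
  exact integral_congr_ae (Filter.Eventually.of_forall fun x => by ring)

end Partition

/-! ### The dual function: coercivity, minimizer, stationarity. -/

section Dual

variable {X ι : Type*} [MeasurableSpace X] [Fintype ι] {ν : Measure X} {φ : ι → X → ℝ}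

/-- The convex dual of the target function. -/
noncomputable def dual (ν : Measure X) (φ : ι → X → ℝ) (Λ μ θ : ι → ℝ) : ℝ :=
  Real.log (partitionFn ν φ θ) + ∑ m, ((θ m) ^ 2 / (2 * Λ m) + μ m * θ m)

theorem continuous_dual (hν : ν ≠ 0) (hD : paramDomain ν φ = Set.univ) (Λ μ : ι → ℝ) :
    Continuous (dual ν φ Λ μ) := by
  refine Continuous.add ((continuous_partitionFn hD).log fun θ =>
    (partitionFn_pos hν hD θ).ne') ?_
  fun_prop

/-- Completing the square in `|t|` with slope `|b| + 1`: the part `|b|` absorbs `b * t`, and the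
remaining `1` leaves linear growth. -/
theorem abs_sub_le_quadratic {l : ℝ} (hl : 0 < l) (b t : ℝ) :
    |t| - l * (|b| + 1) ^ 2 / 2 ≤ t ^ 2 / (2 * l) + b * t := by
  have h1 : -(|b| * |t|) ≤ b * t := by rw [← abs_mul]; exact neg_abs_le _
  have h2 : t ^ 2 / (2 * l) - (|b| + 1) * |t| + l * (|b| + 1) ^ 2 / 2 =
      (|t| - l * (|b| + 1)) ^ 2 / (2 * l) := by
    rw [← sq_abs t]; field_simp; ring
  have h3 : 0 ≤ (|t| - l * (|b| + 1)) ^ 2 / (2 * l) := by positivity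
  linarith

theorem dual_lower_bound (hν : ν ≠ 0) (hD : paramDomain ν φ = Set.univ) {Λ : ι → ℝ}
    (hΛ : ∀ m, 0 < Λ m) (μ : ι → ℝ) : ∃ C, ∀ θ, ‖θ‖ + C ≤ dual ν φ Λ μ θ := by
  -- The affine minorant of log Z_θ has slope `-c`, which turns the linear coefficient `μ` into `μ -
  -- c`.
  set c : ι → ℝ := fun m => (∫ x, φ m x ∂ν) / partitionFn ν φ 0 with hc
  refine ⟨Real.log (partitionFn ν φ 0) - ∑ m, Λ m * (|μ m - c m| + 1) ^ 2 / 2, fun θ => ?_⟩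
  have hZ := partitionFn_pos hν hD 0
  have h1 := Real.log_le_log (by positivity) (partitionFn_lower_bound hν hD θ)
  rw [Real.log_mul hZ.ne' (Real.exp_ne_zero _), Real.log_exp] at h1
  have h2 := Finset.sum_le_sum fun m (_ : m ∈ Finset.univ) =>
    abs_sub_le_quadratic (hΛ m) (μ m - c m) (θ m)
  rw [Finset.sum_sub_distrib] at h2
  have h3 : ‖θ‖ ≤ ∑ m, |θ m| :=
    (pi_norm_le_iff_of_nonneg (Finset.sum_nonneg fun m _ => abs_nonneg _)).2 fun m =>
      Finset.single_le_sum (f := fun m => |θ m|) (fun m _ => abs_nonneg _) (Finset.mem_univ m)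
  have h4 : ∑ m, (θ m ^ 2 / (2 * Λ m) + (μ m - c m) * θ m) =
      ∑ m, (θ m ^ 2 / (2 * Λ m) + μ m * θ m) - ∑ m, θ m * c m := by
    rw [← Finset.sum_sub_distrib]
    exact Finset.sum_congr rfl fun m _ => by ring
  unfold dual
  linarith

theorem exists_dual_minimizer (hν : ν ≠ 0) (hD : paramDomain ν φ = Set.univ) {Λ : ι → ℝ}
    (hΛ : ∀ m, 0 < Λ m) (μ : ι → ℝ) :
    ∃ θ, ∀ θ', dual ν φ Λ μ θ ≤ dual ν φ Λ μ θ' := by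
  obtain ⟨C, hC⟩ := dual_lower_bound hν hD hΛ μ
  refine (continuous_dual hν hD Λ μ).exists_forall_le ?_
  exact Filter.tendsto_atTop_mono hC
    (Filter.tendsto_atTop_add_const_right _ C (tendsto_norm_cocompact_atTop (E := ι → ℝ)))

theorem hasDerivAt_dual [DecidableEq ι] (hν : ν ≠ 0) (hD : paramDomain ν φ = Set.univ)
    (Λ μ θ : ι → ℝ) (m : ι) :
    HasDerivAt (fun t => dual ν φ Λ μ (θ + Pi.single m t))
      (-gibbsMean ν φ m θ + (θ m / Λ m + μ m)) 0 := by
  unfold dual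
  refine HasDerivAt.add ?_ ?_
  · have h := (hasDerivAt_partitionFn hD θ m).log (by
      simpa using (partitionFn_pos hν hD θ).ne')
    simpa [gibbsMean_eq, neg_div] using h
  · have h : ∀ k ∈ (Finset.univ : Finset ι), HasDerivAt
        (fun t : ℝ => ((θ + Pi.single m t : ι → ℝ) k) ^ 2 / (2 * Λ k) +
          μ k * (θ + Pi.single m t : ι → ℝ) k)
        (if k = m then θ m / Λ m + μ m else 0) 0 := by
      intro k _
      rcases eq_or_ne k m with rfl | hk
      · simp only [Pi.add_apply, Pi.single_eq_same, if_true]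
        have h1 : HasDerivAt (fun t : ℝ => θ k + t) 1 0 := (hasDerivAt_id 0).const_add _
        refine (((h1.pow 2).div_const (2 * Λ k)).add (h1.const_mul (μ k))).congr_deriv ?_
        have := mul_div_mul_left (θ k) (Λ k) (two_ne_zero (α := ℝ))
        simp [this]
      · simp only [Pi.add_apply, Pi.single_eq_of_ne hk, if_neg hk]
        exact hasDerivAt_const _ _
    simpa using HasDerivAt.fun_sum h

theorem exists_stationary (hν : ν ≠ 0) (hD : paramDomain ν φ = Set.univ) {Λ : ι → ℝ}
    (hΛ : ∀ m, 0 < Λ m) (μ : ι → ℝ) :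
    ∃ θ : ι → ℝ, ∀ m, θ m = Λ m * (gibbsMean ν φ m θ - μ m) := by
  classical
  obtain ⟨θ, hθ⟩ := exists_dual_minimizer hν hD hΛ μ
  refine ⟨θ, fun m => ?_⟩
  have hmin : IsLocalMin (fun t => dual ν φ Λ μ (θ + Pi.single m t)) 0 :=
    Filter.Eventually.of_forall fun t => by simpa using hθ _
  have h := hmin.hasDerivAt_eq_zero (hasDerivAt_dual hν hD Λ μ θ m)
  have h' : gibbsMean ν φ m θ - μ m = θ m / Λ m := by linarith
  rw [h', mul_div_cancel₀ _ (hΛ m).ne']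

end Dual

/-! ### Gibbs' inequality and optimality. -/

section Entropy

variable {X ι : Type*} [MeasurableSpace X] [Fintype ι] {ν : Measure X} {φ : ι → X → ℝ}

theorem entropy_eq_of_integrable {p : X → ℝ} (h : Integrable (fun x => p x * Real.log (p x)) ν) :
    entropy ν p = ((-∫ x, p x * Real.log (p x) ∂ν : ℝ) : EReal) := by
  have hp : ∫⁻ x, ENNReal.ofReal (p x * Real.log (p x)) ∂ν ≠ ⊤ := h.lintegral_lt_top.ne
  have hn : ∫⁻ x, ENNReal.ofReal (-(p x * Real.log (p x))) ∂ν ≠ ⊤ := h.neg.lintegral_lt_top.ne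
  rw [entropy, integral_eq_lintegral_pos_part_sub_lintegral_neg_part h, neg_sub, EReal.coe_sub,
    EReal.coe_ennreal_toReal hp, EReal.coe_ennreal_toReal hn]

/-- The minorant `g` keeps the negative part of `p log p` integrable, so integrability can only fail
through the positive part. -/
theorem entropy_eq_bot {p g : X → ℝ} (hp : AEStronglyMeasurable p ν) (hg : Integrable g ν)
    (hgp : ∀ᵐ x ∂ν, g x ≤ p x * Real.log (p x))
    (h : ¬ Integrable (fun x => p x * Real.log (p x)) ν) : entropy ν p = ⊥ := by
  have hm : AEStronglyMeasurable (fun x => p x * Real.log (p x)) ν :=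
    (Real.continuous_mul_log.comp_aestronglyMeasurable hp)
  have hn : ∫⁻ x, ENNReal.ofReal (-(p x * Real.log (p x))) ∂ν ≠ ⊤ := by
    refine ne_top_of_le_ne_top hg.neg.lintegral_lt_top.ne (lintegral_mono_ae ?_)
    filter_upwards [hgp] with x hx
    exact ENNReal.ofReal_le_ofReal (neg_le_neg hx)
  have htop : ∫⁻ x, ENNReal.ofReal (p x * Real.log (p x)) ∂ν = ⊤ := by
    by_contra hp'
    refine h ⟨hm, ?_⟩
    rw [hasFiniteIntegral_iff_norm]
    refine lt_of_le_of_lt (lintegral_mono fun x => ?_)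
      (lt_of_le_of_lt (lintegral_add_left' hm.aemeasurable.ennreal_ofReal _).le
        (ENNReal.add_lt_top.2 ⟨lt_top_iff_ne_top.2 hp', lt_top_iff_ne_top.2 hn⟩))
    rw [Real.norm_eq_abs]
    rcases abs_cases (p x * Real.log (p x)) with ⟨h, _⟩ | ⟨h, _⟩ <;> rw [h]
    · exact le_self_add
    · exact le_add_self
  rw [entropy, htop, EReal.coe_ennreal_top, EReal.sub_top]

/-- Pointwise Gibbs inequality, from `log t ≤ t - 1` at `t = b / a`. The term `a - b` integrates to
zero between two probability densities. -/
theorem mul_log_add_le {a b : ℝ} (ha : 0 ≤ a) (hb : 0 < b) :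
    a * Real.log b + (a - b) ≤ a * Real.log a := by
  rcases ha.eq_or_lt with rfl | ha
  · simpa using hb.le
  have h := Real.log_le_sub_one_of_pos (div_pos hb ha)
  rw [Real.log_div hb.ne' ha.ne'] at h
  have h2 := mul_le_mul_of_nonneg_left h ha.le
  have h3 : a * (b / a - 1) = b - a := by field_simp
  linarith

theorem gibbs_pos (hν : ν ≠ 0) (hD : paramDomain ν φ = Set.univ) (θ : ι → ℝ) (x : X) :
    0 < gibbs ν φ θ x :=
  mul_pos (one_div_pos.2 (partitionFn_pos hν hD θ)) (Real.exp_pos _)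

theorem log_gibbs (hν : ν ≠ 0) (hD : paramDomain ν φ = Set.univ) (θ : ι → ℝ) (x : X) :
    Real.log (gibbs ν φ θ x) = -energy φ θ x - Real.log (partitionFn ν φ θ) := by
  have hZ := partitionFn_pos hν hD θ
  rw [gibbs, Real.log_mul (one_div_pos.2 hZ).ne' (Real.exp_ne_zero _), Real.log_exp, one_div,
    Real.log_inv]
  ring

theorem gibbs_mem_densities (hν : ν ≠ 0) (hD : paramDomain ν φ = Set.univ) (θ : ι → ℝ) :
    gibbs ν φ θ ∈ densities ν φ := by
  refine ⟨⟨Filter.Eventually.of_forall fun x => (gibbs_pos hν hD θ x).le,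
    (integrable_exp_neg_energy hD θ).const_mul _, ?_⟩, fun m => ?_⟩
  · simp only [gibbs]
    rw [integral_const_mul]
    exact one_div_mul_cancel (partitionFn_pos hν hD θ).ne'
  · refine ((integrable_mul_exp_neg_energy hD θ m).const_mul (1 / partitionFn ν φ θ)).congr
      (Filter.Eventually.of_forall fun x => ?_)
    simp only [gibbs]; ring

theorem mul_log_gibbs_eq (hν : ν ≠ 0) (hD : paramDomain ν φ = Set.univ) (θ : ι → ℝ)
    (p : X → ℝ) (x : X) :
    p x * Real.log (gibbs ν φ θ x) =
      -(∑ m, θ m * (φ m x * p x)) - Real.log (partitionFn ν φ θ) * p x := by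
  have h : ∑ m, θ m * (φ m x * p x) = energy φ θ x * p x := by
    rw [energy, Finset.sum_mul]
    exact Finset.sum_congr rfl fun m _ => by ring
  rw [h, log_gibbs hν hD]
  ring

theorem integrable_mul_log_gibbs (hν : ν ≠ 0) (hD : paramDomain ν φ = Set.univ) (θ : ι → ℝ)
    {p : X → ℝ} (hp : p ∈ densities ν φ) :
    Integrable (fun x => p x * Real.log (gibbs ν φ θ x)) ν := by
  simp only [mul_log_gibbs_eq hν hD]
  exact (integrable_finsetSum _ fun m _ => (hp.2 m).const_mul (θ m)).neg.sub
    (hp.1.2.1.const_mul _)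

theorem integral_mul_log_gibbs (hν : ν ≠ 0) (hD : paramDomain ν φ = Set.univ) (θ : ι → ℝ)
    {p : X → ℝ} (hp : p ∈ densities ν φ) :
    ∫ x, p x * Real.log (gibbs ν φ θ x) ∂ν =
      -(∑ m, θ m * featureMean ν (φ m) p) - Real.log (partitionFn ν φ θ) := by
  have hs := integrable_finsetSum Finset.univ fun m _ => (hp.2 m).const_mul (θ m)
  simp only [mul_log_gibbs_eq hν hD]
  rw [integral_sub hs.fun_neg (hp.1.2.1.const_mul _), integral_neg,
    integral_finsetSum _ fun m _ => (hp.2 m).const_mul (θ m), integral_const_mul, hp.1.2.2]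
  simp only [integral_const_mul, mul_one, featureMean]

theorem target_gibbs_le (hν : ν ≠ 0) (hD : paramDomain ν φ = Set.univ) {Λ : ι → ℝ}
    (hΛ : ∀ m, 0 < Λ m) {μ θ : ι → ℝ} (hθ : ∀ m, θ m = Λ m * (gibbsMean ν φ m θ - μ m))
    {p : X → ℝ} (hp : p ∈ densities ν φ) :
    target ν φ Λ μ (gibbs ν φ θ) ≤ target ν φ Λ μ p := by
  have hπ := gibbs_mem_densities hν hD θ
  have hg : Integrable
      (fun x => p x * Real.log (gibbs ν φ θ x) + (p x - gibbs ν φ θ x)) ν :=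
    (integrable_mul_log_gibbs hν hD θ hp).add (hp.1.2.1.sub hπ.1.2.1)
  have hle : ∀ᵐ x ∂ν, p x * Real.log (gibbs ν φ θ x) + (p x - gibbs ν φ θ x) ≤
      p x * Real.log (p x) := by
    filter_upwards [hp.1.1] with x hx
    exact mul_log_add_le hx (gibbs_pos hν hD θ x)
  -- If `p log p` is not integrable, then `H(p) = ⊥` and the target is `⊤`.
  by_cases hi : Integrable (fun x => p x * Real.log (p x)) ν
  swap
  · rw [target.eq_def ν φ Λ μ p, entropy_eq_bot hp.1.2.1.aestronglyMeasurable hg hle hi,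
      EReal.coe_sub_bot]
    exact le_top
  have hd : Integrable (fun x => p x - gibbs ν φ θ x) ν := hp.1.2.1.sub hπ.1.2.1
  have h1 := integral_mono_ae hg hi hle
  rw [integral_add (integrable_mul_log_gibbs hν hD θ hp) hd,
    integral_sub hp.1.2.1 hπ.1.2.1, hp.1.2.2, hπ.1.2.2, integral_mul_log_gibbs hν hD θ hp] at h1
  rw [target, target, entropy_eq_of_integrable hi,
    entropy_eq_of_integrable (integrable_mul_log_gibbs hν hD θ hπ), ← EReal.coe_sub,
    ← EReal.coe_sub, EReal.coe_le_coe_iff, integral_mul_log_gibbs hν hD θ hπ]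
  -- By the equation for `θ`, the two sides differ termwise by exactly `Λ_m (η_m(p) - η_m(θ))² / 2`.
  have h2 : ∑ m, (1 / 2 * (Λ m * (featureMean ν (φ m) (gibbs ν φ θ) - μ m) ^ 2) -
        θ m * featureMean ν (φ m) (gibbs ν φ θ)) ≤
      ∑ m, (1 / 2 * (Λ m * (featureMean ν (φ m) p - μ m) ^ 2) - θ m * featureMean ν (φ m) p) := by
    refine Finset.sum_le_sum fun m _ => ?_
    have hm : θ m = Λ m * (featureMean ν (φ m) (gibbs ν φ θ) - μ m) := hθ m
    rw [hm]
    have := mul_nonneg (hΛ m).le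
      (sq_nonneg (featureMean ν (φ m) p - featureMean ν (φ m) (gibbs ν φ θ)))
    linarith
  simp only [Finset.sum_sub_distrib, ← Finset.mul_sum] at h2
  linarith

end Entropy

end EntropicHerding

theorem theorem3 {X ι : Type*} [MeasurableSpace X] [Fintype ι]
    (ν : Measure X) (hν : ν ≠ 0)
    (φ : ι → X → ℝ) (hφ : ∀ m, Measurable (φ m))
    (Λ : ι → ℝ) (hΛ : ∀ m, 0 < Λ m)
    (hD : EntropicHerding.paramDomain ν φ = Set.univ)
    (hA : ∀ m, ∃ A : ℝ, ∀ θ : ι → ℝ, A ≤ EntropicHerding.gibbsMean ν φ m θ)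
    (hB : ∀ m, ∃ B : ℝ, ∀ θ : ι → ℝ, EntropicHerding.gibbsMean ν φ m θ ≤ B)
    (μ : ι → ℝ) :
    ∃ θ : ι → ℝ,
      (∀ m, θ m = Λ m * (EntropicHerding.gibbsMean ν φ m θ - μ m)) ∧
      EntropicHerding.gibbs ν φ θ ∈ EntropicHerding.densities ν φ ∧
      ∀ p ∈ EntropicHerding.densities ν φ,
        EntropicHerding.target ν φ Λ μ (EntropicHerding.gibbs ν φ θ) ≤
          EntropicHerding.target ν φ Λ μ p := by
  obtain ⟨θ, hθ⟩ := EntropicHerding.exists_stationary hν hD hΛ μ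
  exact ⟨θ, hθ, EntropicHerding.gibbs_mem_densities hν hD θ,
    fun p hp => EntropicHerding.target_gibbs_le hν hD hΛ hθ hp⟩
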